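/- Let $K$ be a field, let $0<n_1<n_2<n_3<n_4$ be integers with $\gcd(n_1,n_2,n_3,n_4)=1$, and let $I(C)\subset K[x_1,x_2,x_3,x_4]$ be the kernel of the $K$-algebra homomorphism $K[x_1,\dots,x_4]\to K[t]$, $x_i\mapsto t^{n_i}$. For a polynomial $f$ let $f_*$ be its homogeneous summand of least degree, and let $I(C)_*$ be the ideal generated by the $f_*$ with $f\in I(C)$. A set of generators of an ideal is called minimal if no proper subset of it generates the ideal. Suppose that $I(C)$ is minimally generated by the five polynomials $$f_1=x_1^{a_1}-x_2^{a_{12}}x_3^{a_{13}},\quad f_2=x_2^{a_2}-x_3^{a_{23}}x_4^{a_{24}},\quad f_3=x_3^{a_3}-x_1^{a_{31}}x_4^{a_{34}},$$ $$f_4=x_4^{a_4}-x_1^{a_{41}}x_2^{a_{42}},\quad f_5=x_1^{a_{41}}x_3^{a_{23}}-x_2^{a_{12}}x_4^{a_{34}},$$ where $0<a_{ij}<a_j$ for all exponents $a_{ij}$ that occur. Assume that $a_{41}+a_{23}<a_{12}+a_{34}$ and $a_{13}\le a_{23}$, and put $$f_6=x_2^{a_2+a_{12}}-x_1^{a_1}x_3^{a_{23}-a_{13}}x_4^{a_{24}},\qquad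 f_7=x_1^{a_1+a_{41}}x_3^{a_{23}-a_{13}}-x_2^{2a_{12}}x_4^{a_{34}}.$$ (A) If $a_3\le a_{31}+a_{34}$ and $a_2+a_{12}\le a_1+a_{23}-a_{13}+a_{24}$, then $\{f_1,\dots,f_7\}$ is a standard basis of $I(C)$ with respect to the negative degree reverse lexicographic order with $x_4>x_3>x_2>x_1$; that is, $f_1,\dots,f_7\in I(C)$, and the leading monomials of $f_1,\dots,f_7$ generate the same ideal as the leading monomials of all nonzero elements of $I(C)$. (In this order $x^u>x^v$ if and only if $\deg x^u<\deg x^v$, or $\deg x^u=\deg x^v$ and $u_i<v_i$ for the least $i$ with $u_i\neq v_i$.) (B) In each of the following four cases $I(C)_*$ is minimally generated by the seven listed elements. 1. If $a_3<a_{31}+a_{34}$ and $a_2+a_{12}<a_1+a_{23}-a_{13}+a_{24}$: $$x_2^{a_{12}}x_3^{a_{13}},\ x_3^{a_{23}}x_4^{a_{24}},\ x_3^{a_3},\ x_4^{a_4},\ x_1^{a_{41}}x_3^{a_{23}},\ x_2^{a_2+a_{12}},\ x_2^{2a_{12}}x_4^{a_{34}}.$$ 2. If $a_3<a_{31}+a_{34}$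 and $a_2+a_{12}=a_1+a_{23}-a_{13}+a_{24}$: $$x_2^{a_{12}}x_3^{a_{13}},\ x_3^{a_{23}}x_4^{a_{24}},\ x_3^{a_3},\ x_4^{a_4},\ x_1^{a_{41}}x_3^{a_{23}},\ x_2^{a_2+a_{12}}-x_1^{a_1}x_3^{a_{23}-a_{13}}x_4^{a_{24}},\ x_2^{2a_{12}}x_4^{a_{34}}.$$ 3. If $a_3=a_{31}+a_{34}$ and $a_2+a_{12}<a_1+a_{23}-a_{13}+a_{24}$: $$x_2^{a_{12}}x_3^{a_{13}},\ x_3^{a_{23}}x_4^{a_{24}},\ x_3^{a_3}-x_1^{a_{31}}x_4^{a_{34}},\ x_4^{a_4},\ x_1^{a_{41}}x_3^{a_{23}},\ x_2^{a_2+a_{12}},\ x_2^{2a_{12}}x_4^{a_{34}}.$$ 4. If $a_3=a_{31}+a_{34}$ and $a_2+a_{12}=a_1+a_{23}-a_{13}+a_{24}$: $$x_2^{a_{12}}x_3^{a_{13}},\ x_3^{a_{23}}x_4^{a_{24}},\ x_3^{a_3}-x_1^{a_{31}}x_4^{a_{34}},\ x_4^{a_4},\ x_1^{a_{41}}x_3^{a_{23}},\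 x_2^{a_2+a_{12}}-x_1^{a_1}x_3^{a_{23}-a_{13}}x_4^{a_{24}},\ x_2^{2a_{12}}x_4^{a_{34}}.$$ -/

import Mathlib

namespace MonomialCurve

open MvPolynomial

noncomputable section

/-- The `K`-algebra homomorphism `K[x₁, …, x_d] → K[t]`, `xᵢ ↦ t ^ nᵢ`. The variable `xᵢ` of the
text is `X (i - 1)`, since `Fin d` starts at `0`. -/
def toricHom (K : Type*) [Field K] {d : ℕ} (n : Fin d → ℕ) :
    MvPolynomial (Fin d) K →ₐ[K] Polynomial K :=
  aeval fun i => (Polynomial.X : Polynomial K) ^ n i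

/-- The toric ideal `I(C)` of the monomial curve `C : xᵢ = t ^ nᵢ`. -/
def toricIdeal (K : Type*) [Field K] {d : ℕ} (n : Fin d → ℕ) : Ideal (MvPolynomial (Fin d) K) :=
  RingHom.ker (toricHom K n)

/-- The least total degree of a monomial occurring in `f` (`0` if `f = 0`). -/
def leastDegree {K : Type*} [Field K] {d : ℕ} (f : MvPolynomial (Fin d) K) : ℕ :=
  sInf {k | ∃ u ∈ f.support, u.degree = k}

/-- The homogeneous summand `f_*` of least degree of `f` (`0` if `f = 0`). -/
def leastForm {K : Type*} [Field K] {d : ℕ} (f : MvPolynomial (Fin d) K) :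
    MvPolynomial (Fin d) K :=
  homogeneousComponent (leastDegree f) f

/-- The ideal `I_*` generated by the `f_*` for `f ∈ I`. For `I = I(C)` this is the
defining ideal of the tangent cone of `C` at the origin. -/
def leastFormIdeal {K : Type*} [Field K] {d : ℕ} (I : Ideal (MvPolynomial (Fin d) K)) :
    Ideal (MvPolynomial (Fin d) K) :=
  Ideal.span {g | ∃ f ∈ I, g = leastForm f}

/-- The family `g` minimally generates `I`: it generates `I`, and if any one member is omitted,
the remaining members no longer generate `I`. In particular the members are pairwise distinct. -/
def IsMinimalGenerators {R : Type*} [CommRing R] {r : ℕ} (I : Ideal R) (g : Fin r → R) : Prop :=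
  Ideal.span (Set.range g) = I ∧ ∀ i, Ideal.span (g '' {i}ᶜ) ≠ I

/-- `x ^ v < x ^ u` in the negative degree reverse lexicographic order with
`x_d > ⋯ > x₂ > x₁`: either `x ^ u` has smaller degree, or the degrees agree and, for the smallest
variable whose exponents differ in `u` and `v`, its exponent in `u` is the smaller one. -/
def NegDegRevLexLT {d : ℕ} (v u : Fin d →₀ ℕ) : Prop :=
  u.degree < v.degree ∨
    (u.degree = v.degree ∧ ∃ i, (∀ j < i, u j = v j) ∧ u i < v i)

/-- `x ^ u` is the leading monomial of `f`: the largest monomial occurring in `f`. -/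
def IsLeadingMonomial {K : Type*} [Field K] {d : ℕ} (f : MvPolynomial (Fin d) K)
    (u : Fin d →₀ ℕ) : Prop :=
  u ∈ f.support ∧ ∀ v ∈ f.support, v ≠ u → NegDegRevLexLT v u

/-- The leading ideal of a set `S`: generated by the leading monomials of the nonzero elements
of `S`. -/
def leadingIdeal {K : Type*} [Field K] {d : ℕ} (S : Set (MvPolynomial (Fin d) K)) :
    Ideal (MvPolynomial (Fin d) K) :=
  Ideal.span {m | ∃ f ∈ S, ∃ u, IsLeadingMonomial f u ∧ m = monomial u (1 : K)}

/-- The set `G` is a standard basis of `I` for the negative degree reverse lexicographic order with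
`x_d > ⋯ > x₂ > x₁`. -/
def IsStandardBasis {K : Type*} [Field K] {d : ℕ} (G : Set (MvPolynomial (Fin d) K))
    (I : Ideal (MvPolynomial (Fin d) K)) : Prop :=
  G.Finite ∧ G ⊆ I ∧ leadingIdeal G = leadingIdeal (I : Set (MvPolynomial (Fin d) K))

/-- `I(C)` is given as in case 2(a): the exponents satisfy `0 < a_ij < a_j`, and `I(C)` is minimally
generated by
`f₁ = x₁^a₁ - x₂^a₁₂ x₃^a₁₃`, `f₂ = x₂^a₂ - x₃^a₂₃ x₄^a₂₄`, `f₃ = x₃^a₃ - x₁^a₃₁ x₄^a₃₄`,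
`f₄ = x₄^a₄ - x₁^a₄₁ x₂^a₄₂`, `f₅ = x₁^a₄₁ x₃^a₂₃ - x₂^a₁₂ x₄^a₃₄`. -/
structure IsCaseTwoA (K : Type*) [Field K] (n : Fin 4 → ℕ)
    (a₁ a₂ a₃ a₄ a₁₂ a₁₃ a₂₃ a₂₄ a₃₁ a₃₄ a₄₁ a₄₂ : ℕ) : Prop where
  h₁₂ : 0 < a₁₂ ∧ a₁₂ < a₂
  h₁₃ : 0 < a₁₃ ∧ a₁₃ < a₃
  h₂₃ : 0 < a₂₃ ∧ a₂₃ < a₃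
  h₂₄ : 0 < a₂₄ ∧ a₂₄ < a₄
  h₃₁ : 0 < a₃₁ ∧ a₃₁ < a₁
  h₃₄ : 0 < a₃₄ ∧ a₃₄ < a₄
  h₄₁ : 0 < a₄₁ ∧ a₄₁ < a₁
  h₄₂ : 0 < a₄₂ ∧ a₄₂ < a₂
  minimalGenerators : IsMinimalGenerators (toricIdeal K n)
    ![X 0 ^ a₁ - X 1 ^ a₁₂ * X 2 ^ a₁₃,
      X 1 ^ a₂ - X 2 ^ a₂₃ * X 3 ^ a₂₄,
      X 2 ^ a₃ - X 0 ^ a₃₁ * X 3 ^ a₃₄,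
      X 3 ^ a₄ - X 0 ^ a₄₁ * X 1 ^ a₄₂,
      X 0 ^ a₄₁ * X 2 ^ a₂₃ - X 1 ^ a₁₂ * X 3 ^ a₃₄]

end

end MonomialCurve

namespace MonomialCurve

open MvPolynomial

/-! Each f_i is read as a rule x^(l i) → x^(t i), replacing its leading monomial by its other
monomial. A step raises the degree, or keeps it and raises the exponent of x₁; it preserves the
weight ∑ uⱼ nⱼ, which bounds both quantities, so rewriting terminates. Two different steps from one
monomial can be joined by at most one further step on each side (`diamond_rewriteStep`). Hence every
monomial x^w has a normal form x^(F w), and since F is constant along steps and the rules generate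
I(C), the linear map x^w ↦ x^(F w) kills I(C).

Both claims follow from this. For (A), an irreducible leading monomial of f ∈ I(C) would survive the
map with nonzero coefficient. For (B), f is the sum of c_w (x^w - x^(F w)), and the component of
each difference in the least degree of f lies in the ideal of the least forms of f₁, …, f₇. These
are minimal because no monomial of one least form divides the leading monomial of another.

Joining the steps needs a₁ = a₃₁ + a₄₁, a₂ = a₁₂ + a₄₂, a₃ = a₁₃ + a₂₃, a₄ = a₂₄ + a₃₄. These are
forced: the monomials with the weight of x₂^a₁₂ x₄^a₃₄ are exactly the two in f₅. -/

/-- A terminating relation with the diamond property has normal forms, which are constant along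
the relation. -/
theorem exists_normalForm {α : Type*} {r : α → α → Prop} (hwf : WellFounded (flip r))
    (hd : ∀ a b c, r a b → r a c → ∃ d, Relation.ReflGen r b d ∧ Relation.ReflGen r c d) :
    ∃ F : α → α, (∀ a, Relation.ReflTransGen r a (F a)) ∧ (∀ a b, ¬ r (F a) b) ∧
      ∀ a b, r a b → F a = F b := by
  have hex : ∀ a, ∃ b, Relation.ReflTransGen r a b ∧ ∀ c, ¬ r b c := by
    intro a
    induction a using hwf.induction with
    | _ a ih =>
      by_cases h : ∃ b, r a b
      · obtain ⟨b, hb⟩ := h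
        obtain ⟨c, hbc, hc⟩ := ih b hb
        exact ⟨c, hbc.head hb, hc⟩
      · exact ⟨a, .refl, fun c hc => h ⟨c, hc⟩⟩
  choose F hF hn using hex
  refine ⟨F, hF, hn, fun a b hab => ?_⟩
  obtain ⟨d, h1, h2⟩ := Relation.church_rosser (r := r) (a := a) (b := F a) (c := F b)
    (fun a b c hb hc => (hd a b c hb hc).imp fun _ h => ⟨h.1, h.2.to_reflTransGen⟩)
    (hF a) ((hF b).head hab)
  have e : ∀ {x}, Relation.ReflTransGen r (F x) d → F x = d := fun {x} h => by
    rcases h.cases_head with h | ⟨c, hc, -⟩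
    · exact h
    · exact absurd hc (hn x c)
  rw [e h1, e h2]

/-! ### Binomial ideals and invariants of rewriting -/

section Rewriting

variable {d : ℕ} {ι : Type*}

/-- One rewriting step `x ^ (w + l i) → x ^ (w + t i)` on exponent vectors. -/
def RewriteStep (l t : ι → Fin d →₀ ℕ) (u v : Fin d →₀ ℕ) : Prop :=
  ∃ i w, u = w + l i ∧ v = w + t i

/-- The binomial `x ^ u - x ^ v`. -/
noncomputable def binomial (K : Type*) [Field K] (u v : Fin d →₀ ℕ) : MvPolynomial (Fin d) K :=
  monomial u 1 - monomial v 1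

variable {K : Type*} [Field K]

/-- A function on exponents that is constant along the moves `w + l i ↔ w + t i` induces a linear
map on polynomials that kills the ideal generated by the binomials `x ^ l i - x ^ t i`. -/
theorem sum_single_eq_zero_of_mem_span {α : Type*} (l t : ι → Fin d →₀ ℕ)
    (F : (Fin d →₀ ℕ) → α) (hF : ∀ i w, F (w + l i) = F (w + t i))
    {f : MvPolynomial (Fin d) K}
    (hf : f ∈ Ideal.span (Set.range fun i => binomial K (l i) (t i))) :
    ∑ w ∈ f.support, Finsupp.single (F w) (coeff w f) = 0 := by
  let Φ : MvPolynomial (Fin d) K →ₗ[K] (α →₀ K) :=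
    (basisMonomials (Fin d) K).constr K fun w => Finsupp.single (F w) 1
  have hΦ : ∀ w c, Φ (monomial w c) = Finsupp.single (F w) c := by
    intro w c
    have h1 : Φ (monomial w 1) = Finsupp.single (F w) 1 := by
      have := (basisMonomials (Fin d) K).constr_basis K (fun w => Finsupp.single (F w) (1 : K)) w
      rwa [coe_basisMonomials] at this
    have h2 : monomial w c = c • (monomial w 1 : MvPolynomial (Fin d) K) := by
      rw [smul_monomial, smul_eq_mul, mul_one]
    rw [h2, map_smul, h1, Finsupp.smul_single, smul_eq_mul, mul_one]
  have hzero : Φ f = 0 := by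
    induction hf using Submodule.span_induction with
    | mem x hx =>
      obtain ⟨i, rfl⟩ := hx
      have := hF i 0
      simp only [zero_add] at this
      simp [binomial, hΦ, this]
    | zero => simp
    | add x y _ _ hx hy => rw [map_add, hx, hy, add_zero]
    | smul a x hx ih =>
      clear ih
      -- Φ is only linear, so vanishing at x says nothing about a * x; vanishing is proved for all
      -- multiples at once.
      have key : ∀ i, ∀ a, Φ (a * binomial K (l i) (t i)) = 0 := by
        intro i a
        induction a using MvPolynomial.induction_on' with
        | monomial w c =>
          simp [binomial, mul_sub, monomial_mul, hΦ, hF i w]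
        | add p q hp hq => rw [add_mul, map_add, hp, hq, add_zero]
      have key2 : ∀ a, Φ (a * x) = 0 := by
        induction hx using Submodule.span_induction with
        | mem x hx =>
          obtain ⟨i, rfl⟩ := hx
          exact key i
        | zero => simp
        | add x y _ _ hx hy => intro a; rw [mul_add, map_add, hx, hy, add_zero]
        | smul b x _ hx => intro a; rw [smul_eq_mul, ← mul_assoc]; exact hx _
      exact key2 a
  conv_lhs at hzero => rw [f.as_sum, map_sum]
  simpa only [hΦ] using hzero

/-- Exponents of congruent monomials are not separated by an invariant of the moves. -/
theorem eq_of_binomial_mem_span {α : Type*} (l t : ι → Fin d →₀ ℕ)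
    (F : (Fin d →₀ ℕ) → α) (hF : ∀ i w, F (w + l i) = F (w + t i)) {u v : Fin d →₀ ℕ}
    (h : binomial K u v ∈ Ideal.span (Set.range fun i => binomial K (l i) (t i))) :
    F u = F v := by
  classical
  by_contra hne
  have huv : u ≠ v := fun e => hne (congrArg F e)
  have hs : (binomial K u v).support = {u, v} := by
    ext w
    simp only [binomial, mem_support_iff, coeff_sub, coeff_monomial, Finset.mem_insert,
      Finset.mem_singleton]
    by_cases h1 : u = w <;> by_cases h2 : v = w
    · exact absurd (h1.trans h2.symm) huv
    all_goals simp [h1, h2, eq_comm]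
  have := sum_single_eq_zero_of_mem_span l t F hF h
  rw [hs, Finset.sum_pair huv] at this
  have := DFunLike.congr_fun this (F u)
  simp [binomial, coeff_monomial, huv.symm, Ne.symm hne] at this

end Rewriting

end MonomialCurve

namespace MonomialCurve

open MvPolynomial

/-! ### The local order and termination -/

section LocalOrder

/-- The comparison of monomials by degree, then by the exponent of the first variable: a coarse
version of the negative degree reverse lexicographic order. -/
def DegFirstLT {d : ℕ} (u v : Fin (d + 1) →₀ ℕ) : Prop :=
  u.degree < v.degree ∨ (u.degree = v.degree ∧ u 0 < v 0)

variable {d : ℕ} {ι : Type*}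

theorem DegFirstLT.trans {u v w : Fin (d + 1) →₀ ℕ} (h : DegFirstLT u v) (h' : DegFirstLT v w) :
    DegFirstLT u w := by
  unfold DegFirstLT at *; omega

theorem DegFirstLT.ne {u v : Fin (d + 1) →₀ ℕ} (h : DegFirstLT u v) : u ≠ v := by
  rintro rfl; unfold DegFirstLT at h; omega

theorem DegFirstLT.degree_le {u v : Fin (d + 1) →₀ ℕ} (h : DegFirstLT u v) :
    u.degree ≤ v.degree := by
  unfold DegFirstLT at h; omega

theorem DegFirstLT.negDegRevLexLT {u v : Fin (d + 1) →₀ ℕ} (h : DegFirstLT u v) :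
    NegDegRevLexLT v u := by
  rcases h with h | ⟨h, h0⟩
  · exact .inl h
  · exact .inr ⟨h, 0, fun j hj => absurd hj (Fin.not_lt_zero j), h0⟩

/-- The first variable is compared first among monomials of equal degree, so the fine order can
never reverse a coarse comparison. -/
theorem DegFirstLT.not_negDegRevLexLT {u v : Fin (d + 1) →₀ ℕ} (h : DegFirstLT u v) :
    ¬ NegDegRevLexLT u v := by
  rintro (h' | ⟨h', i, hi, hi'⟩)
  · exact absurd h.degree_le (not_le.2 h')
  · have h0 : u 0 < v 0 := by unfold DegFirstLT at h; omega
    rcases eq_or_ne i 0 with rfl | hne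
    · omega
    · have := hi 0 (Fin.pos_iff_ne_zero.2 hne); omega

variable {l t : ι → Fin (d + 1) →₀ ℕ}

theorem RewriteStep.degFirstLT (hlt : ∀ i, DegFirstLT (l i) (t i)) {u v : Fin (d + 1) →₀ ℕ}
    (h : RewriteStep l t u v) : DegFirstLT u v := by
  obtain ⟨i, w, rfl, rfl⟩ := h
  have := hlt i
  simp only [DegFirstLT, map_add, Finsupp.add_apply] at *
  omega

theorem degFirstLT_of_reflTransGen (hlt : ∀ i, DegFirstLT (l i) (t i)) {u v : Fin (d + 1) →₀ ℕ}
    (h : Relation.ReflTransGen (RewriteStep l t) u v) : u = v ∨ DegFirstLT u v := by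
  induction h with
  | refl => exact .inl rfl
  | tail _ hs ih =>
    have := hs.degFirstLT hlt
    rcases ih with rfl | ih
    · exact .inr this
    · exact .inr (ih.trans this)

/-- Rewriting that raises monomials in a local order and preserves a positive weight terminates. -/
theorem wellFounded_rewriteStep (n : Fin (d + 1) → ℕ) (hn : ∀ i, 0 < n i)
    (hlt : ∀ i, DegFirstLT (l i) (t i)) (hw : ∀ i, ∑ j, l i j * n j = ∑ j, t i j * n j) :
    WellFounded (flip (RewriteStep l t)) := by
  let W : (Fin (d + 1) →₀ ℕ) → ℕ := fun u => ∑ j, u j * n j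
  have hdeg : ∀ u, u.degree ≤ W u := fun u => by
    rw [Finsupp.degree_eq_sum]
    exact Finset.sum_le_sum fun j _ => Nat.le_mul_of_pos_right _ (hn j)
  have h0 : ∀ u, u 0 ≤ W u := fun u =>
    (Nat.le_mul_of_pos_right _ (hn 0)).trans
      (Finset.single_le_sum (f := fun j => u j * n j) (fun _ _ => Nat.zero_le _)
        (Finset.mem_univ 0))
  -- The degree and the exponent of x₁ are at most W u, so the pair is a two-digit number in base W
  -- u + 1. The measure is its distance from the largest such number.
  let μ : (Fin (d + 1) →₀ ℕ) → ℕ := fun u =>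
    ((W u + 1) * W u + W u) - ((W u + 1) * u.degree + u 0)
  refine Subrelation.wf (r := InvImage (· < ·) μ) ?_ (InvImage.wf μ wellFounded_lt)
  intro v u h
  have hlt' := RewriteStep.degFirstLT hlt h
  have hW : W v = W u := by
    obtain ⟨i, w, rfl, rfl⟩ := h
    simp only [W, Finsupp.add_apply, add_mul, Finset.sum_add_distrib, hw i]
  have h1 := hdeg v
  have h2 := h0 v
  have h3 := h0 u
  simp only [InvImage, μ]
  rw [hW] at *
  generalize W u = N at *
  have key : (N + 1) * u.degree + u 0 < (N + 1) * v.degree + v 0 := by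
    rcases hlt' with h | ⟨h, h'⟩
    · nlinarith
    · rw [h]; omega
  have : (N + 1) * v.degree ≤ (N + 1) * N := Nat.mul_le_mul_left _ h1
  omega

end LocalOrder

/-! ### From normal forms to standard bases -/

section StandardBasis

variable {d : ℕ} {ι : Type*} {K : Type*} [Field K] {l t : ι → Fin (d + 1) →₀ ℕ}

theorem coeff_binomial {u v : Fin (d + 1) →₀ ℕ} (huv : u ≠ v) :
    coeff u (binomial K u v) = 1 := by
  classical
  simp [binomial, coeff_monomial, huv.symm]

theorem eq_or_eq_of_mem_support_binomial {u v w : Fin (d + 1) →₀ ℕ}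
    (hw : w ∈ (binomial K u v).support) : w = u ∨ w = v := by
  classical
  by_contra h
  push Not at h
  simp [binomial, coeff_monomial, h.1.symm, h.2.symm] at hw

theorem isLeadingMonomial_binomial {u v : Fin (d + 1) →₀ ℕ} (h : DegFirstLT u v) :
    IsLeadingMonomial (binomial K u v) u := by
  refine ⟨by simp [coeff_binomial h.ne], fun w hw hne => ?_⟩
  rcases eq_or_eq_of_mem_support_binomial hw with rfl | rfl
  · exact absurd rfl hne
  · exact h.negDegRevLexLT

theorem IsLeadingMonomial.neg {f : MvPolynomial (Fin (d + 1)) K} {u : Fin (d + 1) →₀ ℕ}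
    (h : IsLeadingMonomial f u) : IsLeadingMonomial (-f) u := by
  unfold IsLeadingMonomial at *
  rwa [support_neg]

/-- Binomials of an ideal with normal forms for the associated rewriting are a standard basis. -/
theorem isStandardBasis_of_normalForm [Finite ι] {I : Ideal (MvPolynomial (Fin (d + 1)) K)}
    (hlt : ∀ i, DegFirstLT (l i) (t i)) (hI : ∀ i, binomial K (l i) (t i) ∈ I)
    {F : (Fin (d + 1) →₀ ℕ) → Fin (d + 1) →₀ ℕ}
    (hF : ∀ u, Relation.ReflTransGen (RewriteStep l t) u (F u))
    (hsum : ∀ f ∈ I, ∑ w ∈ f.support, Finsupp.single (F w) (coeff w f) = 0)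
    {g : ι → MvPolynomial (Fin (d + 1)) K}
    (hg : ∀ i, g i = binomial K (l i) (t i) ∨ g i = -binomial K (l i) (t i)) :
    IsStandardBasis (Set.range g) I := by
  have hgI : Set.range g ⊆ I := by
    rintro _ ⟨i, rfl⟩
    rcases hg i with h | h <;> rw [h]
    · exact hI i
    · exact I.neg_mem (hI i)
  refine ⟨Set.finite_range g, hgI, le_antisymm (Ideal.span_mono ?_) (Ideal.span_le.2 ?_)⟩
  · rintro m ⟨f, hf, u, hu⟩
    exact ⟨f, hgI hf, u, hu⟩
  · rintro _ ⟨f, hf, u, hu, rfl⟩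
    have hred : ∃ v, RewriteStep l t u v := by
      by_contra! hn
      have hFu : F u = u := by
        rcases (hF u).cases_head with h | ⟨c, hc, -⟩
        · exact h.symm
        · exact absurd hc (hn c)
      -- Only w = u contributes at u: any other w with F w = u would precede u in the rewriting,
      -- hence be larger than the leading monomial.
      have h0 := DFunLike.congr_fun (hsum f hf) u
      rw [Finsupp.finsetSum_apply, Finset.sum_eq_single u] at h0
      · rw [hFu, Finsupp.single_eq_same] at h0
        exact mem_support_iff.1 hu.1 h0
      · intro w hw hne
        refine Finsupp.single_eq_of_ne ?_
        intro hFw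
        rcases degFirstLT_of_reflTransGen hlt (hF w) with h | h
        · exact hne (h.trans hFw.symm)
        · rw [← hFw] at h
          exact h.not_negDegRevLexLT (hu.2 w hw hne)
      · exact fun h => absurd hu.1 h
    obtain ⟨_, i, w, rfl, -⟩ := hred
    have hm : (monomial (l i) 1 : MvPolynomial (Fin (d + 1)) K) ∈ leadingIdeal (Set.range g) := by
      refine Ideal.subset_span ⟨g i, ⟨i, rfl⟩, l i, ?_, rfl⟩
      rcases hg i with h | h <;> rw [h]
      · exact isLeadingMonomial_binomial (hlt i)
      · exact (isLeadingMonomial_binomial (hlt i)).neg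
    have := Ideal.mul_mem_left _ (monomial w 1) hm
    rwa [monomial_mul, one_mul] at this

end StandardBasis

/-! ### Least forms and minimality -/

section TangentCone

variable {d : ℕ} {ι : Type*} {K : Type*} [Field K] {l t : ι → Fin (d + 1) →₀ ℕ}

/-- The part of `x ^ u - x ^ v` in degree `deg x ^ u`. -/
noncomputable def binomialForm (K : Type*) [Field K] {d : ℕ} (u v : Fin d →₀ ℕ) :
    MvPolynomial (Fin d) K :=
  monomial u 1 - if u.degree = v.degree then monomial v 1 else 0

theorem homogeneousComponent_monomial (k : ℕ) (u : Fin (d + 1) →₀ ℕ) (c : K) :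
    homogeneousComponent k (monomial u c) = if u.degree = k then monomial u c else 0 := by
  have := homogeneousComponent_of_mem (m := k) (isHomogeneous_monomial c (rfl : u.degree = u.degree))
  simpa [eq_comm] using this

theorem leastDegree_binomial {u v : Fin (d + 1) →₀ ℕ} (h : DegFirstLT u v) :
    leastDegree (binomial K u v) = u.degree := by
  refine IsLeast.csInf_eq ⟨⟨u, by simp [coeff_binomial h.ne], rfl⟩, ?_⟩
  rintro _ ⟨w, hw, rfl⟩
  rcases eq_or_eq_of_mem_support_binomial hw with rfl | rfl
  · exact le_rfl
  · exact h.degree_le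

theorem leastForm_binomial {u v : Fin (d + 1) →₀ ℕ} (h : DegFirstLT u v) :
    leastForm (binomial K u v) = binomialForm K u v := by
  rw [leastForm, leastDegree_binomial h, binomial, map_sub, homogeneousComponent_monomial,
    homogeneousComponent_monomial, if_pos rfl, binomialForm]
  simp only [eq_comm]

/-- Modulo the least forms, a monomial is congruent to any of its reductions of the same degree, and
to zero if it has a reduction of higher degree. -/
theorem monomial_sub_mem_span_binomialForm (hlt : ∀ i, DegFirstLT (l i) (t i))
    {u v : Fin (d + 1) →₀ ℕ} (h : Relation.ReflTransGen (RewriteStep l t) u v) (c : K) :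
    monomial u c - (if u.degree = v.degree then monomial v c else 0) ∈
      Ideal.span (Set.range fun i => binomialForm K (l i) (t i)) := by
  induction h using Relation.ReflTransGen.head_induction_on with
  | refl => simp
  | @head a b hab hbv ih =>
    have hle : b.degree ≤ v.degree := by
      rcases degFirstLT_of_reflTransGen hlt hbv with rfl | h
      · exact le_rfl
      · exact h.degree_le
    have hlt' := hab.degFirstLT hlt
    obtain ⟨i, w, rfl, rfl⟩ := hab
    have hmem : monomial (w + l i) c -
        (if (w + l i).degree = (w + t i).degree then monomial (w + t i) c else 0) ∈
        Ideal.span (Set.range fun i => binomialForm K (l i) (t i)) := by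
      have := Ideal.mul_mem_left _ (monomial w c)
        (Ideal.subset_span ⟨i, rfl⟩ : binomialForm K (l i) (t i) ∈
          Ideal.span (Set.range fun i => binomialForm K (l i) (t i)))
      have e : monomial w c * binomialForm K (l i) (t i) = monomial (w + l i) c -
          (if (w + l i).degree = (w + t i).degree then monomial (w + t i) c else 0) := by
        simp only [binomialForm, mul_sub, mul_ite, mul_zero, monomial_mul, mul_one, map_add,
          add_right_inj]
      rwa [e] at this
    -- Degrees never drop: once the first step raises the degree, the end of the chain contributes
    -- nothing.
    rcases hlt' with h | ⟨h, -⟩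
    · rw [if_neg h.ne] at hmem
      rwa [if_neg (h.trans_le hle).ne]
    · rw [if_pos h] at hmem
      rw [h]
      have := Ideal.add_mem _ hmem ih
      rwa [sub_add_sub_cancel] at this

/-- The least forms of an ideal are generated by those of binomials of the ideal for which the
associated rewriting has normal forms. -/
theorem leastFormIdeal_eq_span {I : Ideal (MvPolynomial (Fin (d + 1)) K)}
    (hlt : ∀ i, DegFirstLT (l i) (t i)) (hI : ∀ i, binomial K (l i) (t i) ∈ I)
    {F : (Fin (d + 1) →₀ ℕ) → Fin (d + 1) →₀ ℕ}
    (hF : ∀ u, Relation.ReflTransGen (RewriteStep l t) u (F u))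
    (hsum : ∀ f ∈ I, ∑ w ∈ f.support, Finsupp.single (F w) (coeff w f) = 0) :
    Ideal.span (Set.range fun i => binomialForm K (l i) (t i)) = leastFormIdeal I := by
  refine le_antisymm (Ideal.span_mono ?_) (Ideal.span_le.2 ?_)
  · rintro _ ⟨i, rfl⟩
    exact ⟨_, hI i, (leastForm_binomial (hlt i)).symm⟩
  · rintro _ ⟨f, hf, rfl⟩
    have hmin : ∀ w ∈ f.support, leastDegree f ≤ w.degree := fun w hw =>
      Nat.sInf_le ⟨w, hw, rfl⟩
    have hsum' : ∑ w ∈ f.support, monomial (F w) (coeff w f) = 0 := by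
      ext v
      have := DFunLike.congr_fun (hsum f hf) v
      classical
      simpa [Finsupp.finsetSum_apply, coeff_sum, coeff_monomial, Finsupp.single_apply] using this
    -- The subtracted terms add up to zero; they pair each monomial with its normal form.
    have hform : leastForm f = ∑ w ∈ f.support,
        (homogeneousComponent (leastDegree f) (monomial w (coeff w f)) -
          homogeneousComponent (leastDegree f) (monomial (F w) (coeff w f))) := by
      rw [Finset.sum_sub_distrib, ← map_sum, ← map_sum, hsum', map_zero, sub_zero, ← f.as_sum]
      rfl
    rw [SetLike.mem_coe, hform]
    refine Ideal.sum_mem _ fun w hw => ?_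
    rw [homogeneousComponent_monomial, homogeneousComponent_monomial]
    have hwF : w.degree ≤ (F w).degree := by
      rcases degFirstLT_of_reflTransGen hlt (hF w) with h | h
      · exact h ▸ le_rfl
      · exact h.degree_le
    rcases (hmin w hw).eq_or_lt with h | h
    · rw [if_pos h.symm, h]
      simpa only [eq_comm] using monomial_sub_mem_span_binomialForm hlt (hF w) (coeff w f)
    · rw [if_neg h.ne', if_neg (h.trans_le hwF).ne', sub_zero]
      exact Ideal.zero_mem _

/-- A polynomial with a monomial that no monomial of the generators divides is not in their
ideal. -/
theorem coeff_eq_zero_of_mem_span {S : Set (MvPolynomial (Fin d) K)} {u : Fin d →₀ ℕ}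
    (hS : ∀ g ∈ S, ∀ w ∈ g.support, ¬ w ≤ u) {f : MvPolynomial (Fin d) K}
    (hf : f ∈ Ideal.span S) : coeff u f = 0 := by
  classical
  have key : ∀ g ∈ S, ∀ a, coeff u (a * g) = 0 := by
    intro g hg a
    rw [coeff_mul]
    refine Finset.sum_eq_zero fun x hx => ?_
    have hle : x.2 ≤ u := by
      rw [← Finset.HasAntidiagonal.mem_antidiagonal.1 hx]; exact le_add_self
    have : coeff x.2 g = 0 := by
      by_contra h
      exact hS g hg _ (mem_support_iff.2 h) hle
    rw [this, mul_zero]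
  have : ∀ a, coeff u (a * f) = 0 := by
    induction hf using Submodule.span_induction with
    | mem x hx => exact key x hx
    | zero => simp
    | add x y _ _ hx hy => intro a; rw [mul_add, coeff_add, hx, hy, add_zero]
    | smul b x _ hx => intro a; rw [smul_eq_mul, ← mul_assoc]; exact hx _
  simpa using this 1

/-- Least forms of binomials, none of whose monomials divides the leading monomial of another, are
minimal generators of their ideal. -/
theorem span_image_binomialForm_ne {ι : Type*} {l t : ι → Fin (d + 1) →₀ ℕ}
    (hlt : ∀ i, DegFirstLT (l i) (t i)) (hl : ∀ i j, j ≠ i → ¬ l j ≤ l i)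
    (ht : ∀ i j, j ≠ i → (l j).degree = (t j).degree → ¬ t j ≤ l i) (i : ι) :
    Ideal.span ((fun i => binomialForm K (l i) (t i)) '' {i}ᶜ) ≠
      Ideal.span (Set.range fun i => binomialForm K (l i) (t i)) := by
  classical
  intro h
  have hi : binomialForm K (l i) (t i) ∈
      Ideal.span ((fun i => binomialForm K (l i) (t i)) '' {i}ᶜ) := by
    rw [h]; exact Ideal.subset_span ⟨i, rfl⟩
  have h0 := coeff_eq_zero_of_mem_span (u := l i) ?_ hi
  · have := (hlt i).ne
    rw [binomialForm] at h0
    split_ifs at h0 <;> simp [coeff_monomial, this.symm] at h0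
  · rintro _ ⟨j, hj, rfl⟩ w hw hle
    have hw' : w = l j ∨ ((l j).degree = (t j).degree ∧ w = t j) := by
      by_contra hcon
      push Not at hcon
      simp only [binomialForm, mem_support_iff, coeff_sub, coeff_monomial, hcon.1.symm,
        if_false, zero_sub] at hw
      split_ifs at hw with hd
      · simp [coeff_monomial, (hcon.2 hd).symm] at hw
      · simp at hw
    rcases hw' with rfl | ⟨hd, rfl⟩
    · exact hl i j hj hle
    · exact ht i j hj hd hle

end TangentCone

end MonomialCurve

namespace MonomialCurve

open MvPolynomial

/-! ### The seven rules and their critical pairs -/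

section FourVariables

/-- The exponent vector of `x₁ ^ a * x₂ ^ b * x₃ ^ c * x₄ ^ d`. -/
noncomputable def expVec (a b c d : ℕ) : Fin 4 →₀ ℕ := Finsupp.equivFunOnFinite.symm ![a, b, c, d]

@[simp] theorem expVec_zero (a b c d : ℕ) : expVec a b c d 0 = a := rfl
@[simp] theorem expVec_one (a b c d : ℕ) : expVec a b c d 1 = b := rfl
@[simp] theorem expVec_two (a b c d : ℕ) : expVec a b c d 2 = c := rfl
@[simp] theorem expVec_three (a b c d : ℕ) : expVec a b c d 3 = d := rfl

theorem exponent_ext_iff {u v : Fin 4 →₀ ℕ} :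
    u = v ↔ u 0 = v 0 ∧ u 1 = v 1 ∧ u 2 = v 2 ∧ u 3 = v 3 := by
  simp [DFunLike.ext_iff, Fin.forall_fin_succ]

theorem exponent_le_iff {u v : Fin 4 →₀ ℕ} :
    u ≤ v ↔ u 0 ≤ v 0 ∧ u 1 ≤ v 1 ∧ u 2 ≤ v 2 ∧ u 3 ≤ v 3 := by
  simp [Finsupp.le_def, Fin.forall_fin_succ]

theorem degree_expVec (a b c d : ℕ) : (expVec a b c d).degree = a + b + c + d := by
  simp [Finsupp.degree_eq_sum, Fin.sum_univ_four]

variable {K : Type*} [Field K]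

theorem monomial_expVec (a b c d : ℕ) :
    (monomial (expVec a b c d) 1 : MvPolynomial (Fin 4) K) =
      X 0 ^ a * X 1 ^ b * X 2 ^ c * X 3 ^ d := by
  rw [monomial_eq, Finsupp.prod_fintype _ _ (by simp), Fin.prod_univ_four]
  simp

theorem toricHom_monomial {d : ℕ} (n : Fin d → ℕ) (u : Fin d →₀ ℕ) :
    toricHom K n (monomial u 1) = Polynomial.X ^ ∑ j, u j * n j := by
  rw [toricHom, aeval_monomial, map_one, one_mul, Finsupp.prod_fintype _ _ (by simp),
    ← Finset.prod_pow_eq_pow_sum]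
  simp only [← pow_mul, mul_comm]

theorem binomial_mem_toricIdeal {d : ℕ} (n : Fin d → ℕ) (u v : Fin d →₀ ℕ) :
    binomial K u v ∈ toricIdeal K n ↔ ∑ j, u j * n j = ∑ j, v j * n j := by
  rw [toricIdeal, RingHom.mem_ker, binomial, map_sub, toricHom_monomial, toricHom_monomial,
    sub_eq_zero]
  refine ⟨fun h => ?_, fun h => by rw [h]⟩
  simpa only [Polynomial.natDegree_X_pow] using congrArg Polynomial.natDegree h


/-- The leading exponents of `f₁, …, f₇`. -/
noncomputable def leadExp (a₂ a₃ a₄ a₁₂ a₁₃ a₂₃ a₂₄ a₃₄ a₄₁ : ℕ) : Fin 7 → Fin 4 →₀ ℕ :=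
  ![expVec 0 a₁₂ a₁₃ 0, expVec 0 0 a₂₃ a₂₄, expVec 0 0 a₃ 0, expVec 0 0 0 a₄, expVec a₄₁ 0 a₂₃ 0,
    expVec 0 (a₂ + a₁₂) 0 0, expVec 0 (2 * a₁₂) 0 a₃₄]

/-- The exponents of the other terms of `f₁, …, f₇`. -/
noncomputable def tailExp (a₁ a₂ a₁₂ a₁₃ a₂₃ a₂₄ a₃₁ a₃₄ a₄₁ a₄₂ : ℕ) : Fin 7 → Fin 4 →₀ ℕ :=
  ![expVec a₁ 0 0 0, expVec 0 a₂ 0 0, expVec a₃₁ 0 0 a₃₄, expVec a₄₁ a₄₂ 0 0, expVec 0 a₁₂ 0 a₃₄,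
    expVec a₁ 0 (a₂₃ - a₁₃) a₂₄, expVec (a₁ + a₄₁) 0 (a₂₃ - a₁₃) 0]

set_option maxHeartbeats 4000000 in
/-- The critical pairs of the rewriting defined by `f₁, …, f₇` resolve in at most one step on each
side. -/
theorem exists_reduction_of_lt {a₁ a₂ a₃ a₄ a₁₂ a₁₃ a₂₃ a₂₄ a₃₁ a₃₄ a₄₁ a₄₂ : ℕ}
    (e₁ : a₁ = a₃₁ + a₄₁) (e₂ : a₂ = a₁₂ + a₄₂) (e₃ : a₃ = a₁₃ + a₂₃) (e₄ : a₄ = a₂₄ + a₃₄)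
    (h₁₃ : a₁₃ ≤ a₂₃) {l t : Fin 7 → Fin 4 →₀ ℕ}
    (hl : l = leadExp a₂ a₃ a₄ a₁₂ a₁₃ a₂₃ a₂₄ a₃₄ a₄₁)
    (ht : t = tailExp a₁ a₂ a₁₂ a₁₃ a₂₃ a₂₄ a₃₁ a₃₄ a₄₁ a₄₂)
    {i j : Fin 7} (hij : i < j) {w w' : Fin 4 →₀ ℕ} (h : w + l i = w' + l j) :
    (∃ k k', l k ≤ w + t i ∧ l k' ≤ w' + t j ∧
        w + t i - l k + t k = w' + t j - l k' + t k') ∨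
      (∃ k, l k ≤ w + t i ∧ w + t i - l k + t k = w' + t j) ∨
      ∃ k, l k ≤ w' + t j ∧ w' + t j - l k + t k = w + t i := by
  subst hl ht
  fin_cases i <;> fin_cases j <;> first | exact absurd hij (by decide) | skip
  -- The overlap of f₁ and f₂ is closed by f₆, and below that of f₁ and f₅ by f₇: this is where
  -- these two come from. Pairs with coprime leading monomials are closed by applying each rule
  -- after the other.
  · refine .inr (.inr ⟨5, ?_, ?_⟩)
    all_goals simp [leadExp, tailExp, exponent_ext_iff, exponent_le_iff] at h ⊢; omega
  · refine .inr (.inl ⟨4, ?_, ?_⟩)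
    all_goals simp [leadExp, tailExp, exponent_ext_iff, exponent_le_iff] at h ⊢; omega
  · refine .inl ⟨3, 0, ?_, ?_, ?_⟩
    all_goals simp [leadExp, tailExp, exponent_ext_iff, exponent_le_iff] at h ⊢; omega
  · refine .inr (.inr ⟨6, ?_, ?_⟩)
    all_goals simp [leadExp, tailExp, exponent_ext_iff, exponent_le_iff] at h ⊢; omega
  · refine .inr (.inr ⟨1, ?_, ?_⟩)
    all_goals simp [leadExp, tailExp, exponent_ext_iff, exponent_le_iff] at h ⊢; omega
  · refine .inr (.inr ⟨4, ?_, ?_⟩)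
    all_goals simp [leadExp, tailExp, exponent_ext_iff, exponent_le_iff] at h ⊢; omega
  · refine .inl ⟨0, 3, ?_, ?_, ?_⟩
    all_goals simp [leadExp, tailExp, exponent_ext_iff, exponent_le_iff] at h ⊢; omega
  · refine .inr (.inr ⟨4, ?_, ?_⟩)
    all_goals simp [leadExp, tailExp, exponent_ext_iff, exponent_le_iff] at h ⊢; omega
  · refine .inr (.inr ⟨3, ?_, ?_⟩)
    all_goals simp [leadExp, tailExp, exponent_ext_iff, exponent_le_iff] at h ⊢; omega
  · refine .inl ⟨5, 1, ?_, ?_, ?_⟩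
    all_goals simp [leadExp, tailExp, exponent_ext_iff, exponent_le_iff] at h ⊢; omega
  · refine .inl ⟨5, 4, ?_, ?_, ?_⟩
    all_goals simp [leadExp, tailExp, exponent_ext_iff, exponent_le_iff] at h ⊢; omega
  · refine .inl ⟨3, 2, ?_, ?_, ?_⟩
    all_goals simp [leadExp, tailExp, exponent_ext_iff, exponent_le_iff] at h ⊢; omega
  · refine .inr (.inr ⟨0, ?_, ?_⟩)
    all_goals simp [leadExp, tailExp, exponent_ext_iff, exponent_le_iff] at h ⊢; omega
  · refine .inl ⟨5, 2, ?_, ?_, ?_⟩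
    all_goals simp [leadExp, tailExp, exponent_ext_iff, exponent_le_iff] at h ⊢; omega
  · refine .inl ⟨6, 2, ?_, ?_, ?_⟩
    all_goals simp [leadExp, tailExp, exponent_ext_iff, exponent_le_iff] at h ⊢; omega
  · refine .inl ⟨4, 3, ?_, ?_, ?_⟩
    all_goals simp [leadExp, tailExp, exponent_ext_iff, exponent_le_iff] at h ⊢; omega
  · refine .inl ⟨5, 3, ?_, ?_, ?_⟩
    all_goals simp [leadExp, tailExp, exponent_ext_iff, exponent_le_iff] at h ⊢; omega
  · refine .inr (.inl ⟨5, ?_, ?_⟩)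
    all_goals simp [leadExp, tailExp, exponent_ext_iff, exponent_le_iff] at h ⊢; omega
  · refine .inl ⟨5, 4, ?_, ?_, ?_⟩
    all_goals simp [leadExp, tailExp, exponent_ext_iff, exponent_le_iff] at h ⊢; omega
  · refine .inl ⟨6, 4, ?_, ?_, ?_⟩
    all_goals simp [leadExp, tailExp, exponent_ext_iff, exponent_le_iff] at h ⊢; omega
  · refine .inr (.inl ⟨3, ?_, ?_⟩)
    all_goals simp [leadExp, tailExp, exponent_ext_iff, exponent_le_iff] at h ⊢; omega

theorem rewriteStep_of_le {d : ℕ} {ι : Type*} {l t : ι → Fin d →₀ ℕ} {u v : Fin d →₀ ℕ} {k : ι}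
    (h : l k ≤ u) (e : u - l k + t k = v) : RewriteStep l t u v :=
  ⟨k, u - l k, (tsub_add_cancel_of_le h).symm, e.symm⟩

theorem diamond_rewriteStep {a₁ a₂ a₃ a₄ a₁₂ a₁₃ a₂₃ a₂₄ a₃₁ a₃₄ a₄₁ a₄₂ : ℕ}
    (e₁ : a₁ = a₃₁ + a₄₁) (e₂ : a₂ = a₁₂ + a₄₂) (e₃ : a₃ = a₁₃ + a₂₃) (e₄ : a₄ = a₂₄ + a₃₄)
    (h₁₃ : a₁₃ ≤ a₂₃) {l t : Fin 7 → Fin 4 →₀ ℕ}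
    (hl : l = leadExp a₂ a₃ a₄ a₁₂ a₁₃ a₂₃ a₂₄ a₃₄ a₄₁)
    (ht : t = tailExp a₁ a₂ a₁₂ a₁₃ a₂₃ a₂₄ a₃₁ a₃₄ a₄₁ a₄₂) (u v v' : Fin 4 →₀ ℕ)
    (hv : RewriteStep l t u v) (hv' : RewriteStep l t u v') :
    ∃ z, Relation.ReflGen (RewriteStep l t) v z ∧ Relation.ReflGen (RewriteStep l t) v' z := by
  have key : ∀ {i j : Fin 7}, i < j → ∀ {w w' : Fin 4 →₀ ℕ}, w + l i = w' + l j →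
      ∃ z, Relation.ReflGen (RewriteStep l t) (w + t i) z ∧
        Relation.ReflGen (RewriteStep l t) (w' + t j) z := by
    intro i j hij w w' h
    rcases exists_reduction_of_lt e₁ e₂ e₃ e₄ h₁₃ hl ht hij h with
      ⟨k, k', hk, hk', e⟩ | ⟨k, hk, e⟩ | ⟨k, hk, e⟩
    · exact ⟨_, .single (rewriteStep_of_le hk e), .single (rewriteStep_of_le hk' rfl)⟩
    · exact ⟨_, .single (rewriteStep_of_le hk e), .refl⟩
    · exact ⟨_, .refl, .single (rewriteStep_of_le hk e)⟩
  obtain ⟨i, w, rfl, rfl⟩ := hv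
  obtain ⟨j, w', h, rfl⟩ := hv'
  rcases lt_trichotomy i j with hij | rfl | hij
  · exact key hij h
  · rw [add_right_cancel h]
    exact ⟨_, .refl, .refl⟩
  · exact (key hij h.symm).imp fun _ hz => hz.symm

end FourVariables

end MonomialCurve

namespace MonomialCurve

open MvPolynomial

/-! ### Exponent relations and degrees for I(C) -/

section CaseTwoA

variable {K : Type*} [Field K] {n : Fin 4 → ℕ}
  {a₁ a₂ a₃ a₄ a₁₂ a₁₃ a₂₃ a₂₄ a₃₁ a₃₄ a₄₁ a₄₂ : ℕ}

theorem binomial_expVec_mem_toricIdeal {a b c d a' b' c' d' : ℕ} :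
    binomial K (expVec a b c d) (expVec a' b' c' d') ∈ toricIdeal K n ↔
      a * n 0 + b * n 1 + c * n 2 + d * n 3 = a' * n 0 + b' * n 1 + c' * n 2 + d' * n 3 := by
  simp [binomial_mem_toricIdeal, Fin.sum_univ_four]

theorem binomial_expVec (a b c d a' b' c' d' : ℕ) :
    binomial K (expVec a b c d) (expVec a' b' c' d') =
      X 0 ^ a * X 1 ^ b * X 2 ^ c * X 3 ^ d - X 0 ^ a' * X 1 ^ b' * X 2 ^ c' * X 3 ^ d' := by
  rw [binomial, monomial_expVec, monomial_expVec]

theorem binomialForm_expVec_of_degree_lt {a b c d a' b' c' d' : ℕ}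
    (h : a + b + c + d < a' + b' + c' + d') :
    binomialForm K (expVec a b c d) (expVec a' b' c' d') =
      X 0 ^ a * X 1 ^ b * X 2 ^ c * X 3 ^ d := by
  rw [binomialForm, degree_expVec, degree_expVec, if_neg h.ne, sub_zero, monomial_expVec]

theorem binomialForm_expVec_of_degree_eq {a b c d a' b' c' d' : ℕ}
    (h : a + b + c + d = a' + b' + c' + d') :
    binomialForm K (expVec a b c d) (expVec a' b' c' d') =
      X 0 ^ a * X 1 ^ b * X 2 ^ c * X 3 ^ d - X 0 ^ a' * X 1 ^ b' * X 2 ^ c' * X 3 ^ d' := by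
  rw [binomialForm, degree_expVec, degree_expVec, if_pos h, monomial_expVec, monomial_expVec]

theorem IsCaseTwoA.toricIdeal_le_span
    (hC : IsCaseTwoA K n a₁ a₂ a₃ a₄ a₁₂ a₁₃ a₂₃ a₂₄ a₃₁ a₃₄ a₄₁ a₄₂) :
    toricIdeal K n ≤ Ideal.span (Set.range fun i =>
      binomial K (leadExp a₂ a₃ a₄ a₁₂ a₁₃ a₂₃ a₂₄ a₃₄ a₄₁ i)
        (tailExp a₁ a₂ a₁₂ a₁₃ a₂₃ a₂₄ a₃₁ a₃₄ a₄₁ a₄₂ i)) := by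
  rw [← hC.minimalGenerators.1, Ideal.span_le]
  rintro _ ⟨i, rfl⟩
  have key : ∀ i : Fin 7, binomial K (leadExp a₂ a₃ a₄ a₁₂ a₁₃ a₂₃ a₂₄ a₃₄ a₄₁ i)
      (tailExp a₁ a₂ a₁₂ a₁₃ a₂₃ a₂₄ a₃₁ a₃₄ a₄₁ a₄₂ i) ∈ Ideal.span (Set.range fun i =>
      binomial K (leadExp a₂ a₃ a₄ a₁₂ a₁₃ a₂₃ a₂₄ a₃₄ a₄₁ i)
        (tailExp a₁ a₂ a₁₂ a₁₃ a₂₃ a₂₄ a₃₁ a₃₄ a₄₁ a₄₂ i)) :=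
    fun i => Ideal.subset_span ⟨i, rfl⟩
  generalize Ideal.span (Set.range fun i =>
      binomial K (leadExp a₂ a₃ a₄ a₁₂ a₁₃ a₂₃ a₂₄ a₃₄ a₄₁ i)
        (tailExp a₁ a₂ a₁₂ a₁₃ a₂₃ a₂₄ a₃₁ a₃₄ a₄₁ a₄₂ i)) = J at key ⊢
  -- In f₁ and f₂ the leading term is the second one, so the rule is the negated generator.
  have k0 := J.neg_mem (key 0)
  have k1 := J.neg_mem (key 1)
  have k2 := key 2
  have k3 := key 3
  have k4 := key 4
  simp [leadExp, tailExp, binomial_expVec] at k0 k1 k2 k3 k4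
  fin_cases i <;> simpa

theorem IsCaseTwoA.weights
    (hC : IsCaseTwoA K n a₁ a₂ a₃ a₄ a₁₂ a₁₃ a₂₃ a₂₄ a₃₁ a₃₄ a₄₁ a₄₂) :
    a₁ * n 0 = a₁₂ * n 1 + a₁₃ * n 2 ∧ a₂ * n 1 = a₂₃ * n 2 + a₂₄ * n 3 ∧
      a₃ * n 2 = a₃₁ * n 0 + a₃₄ * n 3 ∧ a₄ * n 3 = a₄₁ * n 0 + a₄₂ * n 1 ∧
      a₄₁ * n 0 + a₂₃ * n 2 = a₁₂ * n 1 + a₃₄ * n 3 := by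
  have key : ∀ i, _ ∈ toricIdeal K n := fun i =>
    hC.minimalGenerators.1.le (Ideal.subset_span (Set.mem_range_self i))
  have w0 := (binomial_expVec_mem_toricIdeal (K := K) (n := n) (a := a₁) (b := 0) (c := 0)
    (d := 0) (a' := 0) (b' := a₁₂) (c' := a₁₃) (d' := 0)).1
    (by rw [binomial_expVec]; simpa using key 0)
  have w1 := (binomial_expVec_mem_toricIdeal (K := K) (n := n) (a := 0) (b := a₂) (c := 0)
    (d := 0) (a' := 0) (b' := 0) (c' := a₂₃) (d' := a₂₄)).1
    (by rw [binomial_expVec]; simpa using key 1)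
  have w2 := (binomial_expVec_mem_toricIdeal (K := K) (n := n) (a := 0) (b := 0) (c := a₃)
    (d := 0) (a' := a₃₁) (b' := 0) (c' := 0) (d' := a₃₄)).1
    (by rw [binomial_expVec]; simpa using key 2)
  have w3 := (binomial_expVec_mem_toricIdeal (K := K) (n := n) (a := 0) (b := 0) (c := 0)
    (d := a₄) (a' := a₄₁) (b' := a₄₂) (c' := 0) (d' := 0)).1
    (by rw [binomial_expVec]; simpa using key 3)
  have w4 := (binomial_expVec_mem_toricIdeal (K := K) (n := n) (a := a₄₁) (b := 0) (c := a₂₃)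
    (d := 0) (a' := 0) (b' := a₁₂) (c' := 0) (d' := a₃₄)).1
    (by rw [binomial_expVec]; simpa using key 4)
  simp only [zero_mul, zero_add, add_zero] at w0 w1 w2 w3 w4
  exact ⟨w0, w1, w2, w3, w4⟩

/-- The only monomial in the fibre of `x₂ ^ a₁₂ * x₄ ^ a₃₄` besides itself is
`x₁ ^ a₄₁ * x₃ ^ a₂₃`. -/
theorem IsCaseTwoA.eq_or_eq_of_weight_eq
    (hC : IsCaseTwoA K n a₁ a₂ a₃ a₄ a₁₂ a₁₃ a₂₃ a₂₄ a₃₁ a₃₄ a₄₁ a₄₂) {a b c d : ℕ}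
    (h : a * n 0 + b * n 1 + c * n 2 + d * n 3 = a₁₂ * n 1 + a₃₄ * n 3) :
    expVec a b c d = expVec 0 a₁₂ 0 a₃₄ ∨ expVec a b c d = expVec a₄₁ 0 a₂₃ 0 := by
  have hmem : binomial K (expVec a b c d) (expVec 0 a₁₂ 0 a₃₄) ∈ toricIdeal K n :=
    binomial_expVec_mem_toricIdeal.2 (by simpa using h)
  -- The invariant is the proposition "w is one of the two". By 0 < a_ij < a_j, only the move of f₅
  -- with trivial cofactor meets this set, and it swaps the two.
  have := eq_of_binomial_mem_span _ _
    (fun w => w = expVec 0 a₁₂ 0 a₃₄ ∨ w = expVec a₄₁ 0 a₂₃ 0) ?_ (hC.toricIdeal_le_span hmem)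
  · exact (iff_of_eq this).2 (.inl rfl)
  · intro i w
    have := hC.h₁₂
    have := hC.h₁₃
    have := hC.h₂₃
    have := hC.h₂₄
    have := hC.h₃₁
    have := hC.h₃₄
    have := hC.h₄₁
    have := hC.h₄₂
    fin_cases i <;> refine propext ?_ <;> simp [leadExp, tailExp, exponent_ext_iff] <;> omega

/-- Adding the weight relations of f₁ and f₃ and cancelling puts x₁^(a₁-a₃₁) x₃^(a₃-a₁₃) into the
two-element fibre; f₂ and f₄ do the same for x₂^(a₂-a₄₂) x₄^(a₄-a₂₄). Positivity of the exponents
decides which element each one is. -/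
theorem IsCaseTwoA.relations
    (hC : IsCaseTwoA K n a₁ a₂ a₃ a₄ a₁₂ a₁₃ a₂₃ a₂₄ a₃₁ a₃₄ a₄₁ a₄₂) :
    a₁ = a₃₁ + a₄₁ ∧ a₂ = a₁₂ + a₄₂ ∧ a₃ = a₁₃ + a₂₃ ∧ a₄ = a₂₄ + a₃₄ := by
  obtain ⟨w1, w2, w3, w4, w5⟩ := hC.weights
  obtain ⟨b, hb⟩ := Nat.exists_eq_add_of_lt hC.h₃₁.2
  obtain ⟨c, hc⟩ := Nat.exists_eq_add_of_lt hC.h₁₃.2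
  obtain ⟨p, hp⟩ := Nat.exists_eq_add_of_lt hC.h₄₂.2
  obtain ⟨q, hq⟩ := Nat.exists_eq_add_of_lt hC.h₂₄.2
  have r1 := hC.eq_or_eq_of_weight_eq (a := b + 1) (b := 0) (c := c + 1) (d := 0) (by
    rw [hb] at w1; rw [hc] at w3; linarith)
  have r2 := hC.eq_or_eq_of_weight_eq (a := 0) (b := p + 1) (c := 0) (d := q + 1) (by
    rw [hp] at w2; rw [hq] at w4; linarith)
  simp [exponent_ext_iff] at r1 r2
  omega

theorem IsCaseTwoA.binomial_mem
    (hC : IsCaseTwoA K n a₁ a₂ a₃ a₄ a₁₂ a₁₃ a₂₃ a₂₄ a₃₁ a₃₄ a₄₁ a₄₂) (h₁₃ : a₁₃ ≤ a₂₃) (i : Fin 7) :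
    binomial K (leadExp a₂ a₃ a₄ a₁₂ a₁₃ a₂₃ a₂₄ a₃₄ a₄₁ i)
        (tailExp a₁ a₂ a₁₂ a₁₃ a₂₃ a₂₄ a₃₁ a₃₄ a₄₁ a₄₂ i) ∈ toricIdeal K n := by
  obtain ⟨w1, w2, w3, w4, w5⟩ := hC.weights
  -- This removes the truncated subtraction a₂₃ - a₁₃.
  obtain ⟨b, rfl⟩ := Nat.exists_eq_add_of_le h₁₃
  fin_cases i <;> refine binomial_expVec_mem_toricIdeal.2 ?_ <;>
    simp only [add_tsub_cancel_left, zero_mul, zero_add, add_zero] <;> linarith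

/-- At equal weight, the side made of lighter variables has the larger degree; x₁ is lightest, x₄
heaviest, and x₂ lighter than x₃ and x₄. -/
theorem IsCaseTwoA.degree_lt
    (hC : IsCaseTwoA K n a₁ a₂ a₃ a₄ a₁₂ a₁₃ a₂₃ a₂₄ a₃₁ a₃₄ a₄₁ a₄₂)
    (hn : StrictMono n) : a₁₂ + a₁₃ < a₁ ∧ a₂₃ + a₂₄ < a₂ ∧ a₄ < a₄₁ + a₄₂ := by
  obtain ⟨w1, w2, w3, w4, w5⟩ := hC.weights
  have n01 : n 0 < n 1 := hn (by decide)
  have n12 : n 1 < n 2 := hn (by decide)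
  have n23 : n 2 < n 3 := hn (by decide)
  refine ⟨lt_of_mul_lt_mul_right (a := n 0) ?_ (Nat.zero_le _),
    lt_of_mul_lt_mul_right (a := n 1) ?_ (Nat.zero_le _),
    lt_of_mul_lt_mul_right (a := n 3) ?_ (Nat.zero_le _)⟩
  · rw [w1, add_mul]
    exact add_lt_add (Nat.mul_lt_mul_of_pos_left n01 hC.h₁₂.1)
      (Nat.mul_lt_mul_of_pos_left (n01.trans n12) hC.h₁₃.1)
  · rw [w2, add_mul]
    exact add_lt_add (Nat.mul_lt_mul_of_pos_left n12 hC.h₂₃.1)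
      (Nat.mul_lt_mul_of_pos_left (n12.trans n23) hC.h₂₄.1)
  · rw [w4, add_mul]
    exact add_lt_add (Nat.mul_lt_mul_of_pos_left (n01.trans (n12.trans n23)) hC.h₄₁.1)
      (Nat.mul_lt_mul_of_pos_left (n12.trans n23) hC.h₄₂.1)

/-- Ties in degree are possible only for f₃ and f₆, where x₁ occurs in the tail alone. For f₇,
adding `h₆` to a₄ < a₄₁ + a₄₂ gives a strict inequality. -/
theorem IsCaseTwoA.degFirstLT
    (hC : IsCaseTwoA K n a₁ a₂ a₃ a₄ a₁₂ a₁₃ a₂₃ a₂₄ a₃₁ a₃₄ a₄₁ a₄₂)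
    (hn : StrictMono n)
    (h₅ : a₄₁ + a₂₃ < a₁₂ + a₃₄) (h₃ : a₃ ≤ a₃₁ + a₃₄)
    (h₆ : a₂ + a₁₂ ≤ a₁ + (a₂₃ - a₁₃) + a₂₄) (i : Fin 7) :
    DegFirstLT (leadExp a₂ a₃ a₄ a₁₂ a₁₃ a₂₃ a₂₄ a₃₄ a₄₁ i)
      (tailExp a₁ a₂ a₁₂ a₁₃ a₂₃ a₂₄ a₃₁ a₃₄ a₄₁ a₄₂ i) := by
  obtain ⟨e1, e2, e3, e4⟩ := hC.relations
  obtain ⟨d1, d2, d4⟩ := hC.degree_lt hn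
  have := hC.h₁₂
  have := hC.h₂₃
  have := hC.h₃₁
  fin_cases i <;> simp [leadExp, tailExp, DegFirstLT, degree_expVec] <;> omega

/-- The normal form map of the rewriting, and the fact that it annihilates `I(C)`. -/
theorem IsCaseTwoA.exists_normalForm
    (hC : IsCaseTwoA K n a₁ a₂ a₃ a₄ a₁₂ a₁₃ a₂₃ a₂₄ a₃₁ a₃₄ a₄₁ a₄₂)
    (hn : StrictMono n) (hpos : ∀ i, 0 < n i)
    (h₅ : a₄₁ + a₂₃ < a₁₂ + a₃₄) (h₁₃ : a₁₃ ≤ a₂₃) (h₃ : a₃ ≤ a₃₁ + a₃₄)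
    (h₆ : a₂ + a₁₂ ≤ a₁ + (a₂₃ - a₁₃) + a₂₄) :
    ∃ F : (Fin 4 →₀ ℕ) → Fin 4 →₀ ℕ,
      (∀ u, Relation.ReflTransGen (RewriteStep (leadExp a₂ a₃ a₄ a₁₂ a₁₃ a₂₃ a₂₄ a₃₄ a₄₁)
        (tailExp a₁ a₂ a₁₂ a₁₃ a₂₃ a₂₄ a₃₁ a₃₄ a₄₁ a₄₂)) u (F u)) ∧
      ∀ f ∈ toricIdeal K n, ∑ w ∈ f.support, Finsupp.single (F w) (coeff w f) = 0 := by
  obtain ⟨e1, e2, e3, e4⟩ := hC.relations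
  obtain ⟨F, hF, -, hF'⟩ := MonomialCurve.exists_normalForm
    (wellFounded_rewriteStep n hpos (hC.degFirstLT hn h₅ h₃ h₆)
      fun i => (binomial_mem_toricIdeal n _ _).1 (hC.binomial_mem h₁₃ i))
    (diamond_rewriteStep e1 e2 e3 e4 h₁₃ rfl rfl)
  exact ⟨F, hF, fun f hf => sum_single_eq_zero_of_mem_span _ _ F
    (fun i w => hF' _ _ ⟨i, w, rfl, rfl⟩) (hC.toricIdeal_le_span hf)⟩

theorem IsCaseTwoA.isMinimalGenerators_binomialForm
    (hC : IsCaseTwoA K n a₁ a₂ a₃ a₄ a₁₂ a₁₃ a₂₃ a₂₄ a₃₁ a₃₄ a₄₁ a₄₂)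
    (hn : StrictMono n) (hpos : ∀ i, 0 < n i)
    (h₅ : a₄₁ + a₂₃ < a₁₂ + a₃₄) (h₁₃ : a₁₃ ≤ a₂₃) (h₃ : a₃ ≤ a₃₁ + a₃₄)
    (h₆ : a₂ + a₁₂ ≤ a₁ + (a₂₃ - a₁₃) + a₂₄) :
    IsMinimalGenerators (leastFormIdeal (toricIdeal K n)) fun i =>
      binomialForm K (leadExp a₂ a₃ a₄ a₁₂ a₁₃ a₂₃ a₂₄ a₃₄ a₄₁ i)
        (tailExp a₁ a₂ a₁₂ a₁₃ a₂₃ a₂₄ a₃₁ a₃₄ a₄₁ a₄₂ i) := by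
  obtain ⟨F, hF, hF'⟩ := hC.exists_normalForm hn hpos h₅ h₁₃ h₃ h₆
  have hlt := hC.degFirstLT hn h₅ h₃ h₆
  have hspan := leastFormIdeal_eq_span hlt (hC.binomial_mem h₁₃) hF hF'
  refine ⟨hspan, fun i => ?_⟩
  rw [← hspan]
  obtain ⟨e1, e2, e3, e4⟩ := hC.relations
  have := hC.h₁₂
  have := hC.h₁₃
  have := hC.h₂₃
  have := hC.h₂₄
  have := hC.h₃₁
  have := hC.h₃₄
  have := hC.h₄₁
  have := hC.h₄₂
  refine span_image_binomialForm_ne hlt (fun i j hij => ?_) (fun i j hij hd => ?_) i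
  · fin_cases i <;> fin_cases j <;> first
      | exact absurd rfl hij
      | (simp [leadExp, exponent_le_iff]; done)
      | (simp [leadExp, exponent_le_iff]; omega)
  -- A tail of the same degree as its leading monomial belongs to f₃ or f₆, so it contains both x₁
  -- and x₄; no leading monomial does.
  · have hj : (tailExp a₁ a₂ a₁₂ a₁₃ a₂₃ a₂₄ a₃₁ a₃₄ a₄₁ a₄₂ j) 0 ≠ 0 ∧
        (tailExp a₁ a₂ a₁₂ a₁₃ a₂₃ a₂₄ a₃₁ a₃₄ a₄₁ a₄₂ j) 3 ≠ 0 := by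
      obtain ⟨d1, d2, d4⟩ := hC.degree_lt hn
      fin_cases j <;> simp [leadExp, tailExp, degree_expVec] at hd ⊢ <;> omega
    rw [exponent_le_iff]
    fin_cases i <;> simp [leadExp] <;> omega

end CaseTwoA

end MonomialCurve

theorem theorem3p5 {K : Type*} [Field K] (n : Fin 4 → ℕ)
    (hpos : ∀ i, 0 < n i) (hmono : StrictMono n) (hgcd : Finset.univ.gcd n = 1)
    (a₁ a₂ a₃ a₄ a₁₂ a₁₃ a₂₃ a₂₄ a₃₁ a₃₄ a₄₁ a₄₂ : ℕ)
    (hC : MonomialCurve.IsCaseTwoA K n a₁ a₂ a₃ a₄ a₁₂ a₁₃ a₂₃ a₂₄ a₃₁ a₃₄ a₄₁ a₄₂)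
    (h₅ : a₄₁ + a₂₃ < a₁₂ + a₃₄) (h₁₃ : a₁₃ ≤ a₂₃) :
    (a₃ ≤ a₃₁ + a₃₄ → a₂ + a₁₂ ≤ a₁ + (a₂₃ - a₁₃) + a₂₄ →
      MonomialCurve.IsStandardBasis
        (Set.range (![MvPolynomial.X 0 ^ a₁ - MvPolynomial.X 1 ^ a₁₂ * MvPolynomial.X 2 ^ a₁₃,
          MvPolynomial.X 1 ^ a₂ - MvPolynomial.X 2 ^ a₂₃ * MvPolynomial.X 3 ^ a₂₄,
          MvPolynomial.X 2 ^ a₃ - MvPolynomial.X 0 ^ a₃₁ * MvPolynomial.X 3 ^ a₃₄,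
          MvPolynomial.X 3 ^ a₄ - MvPolynomial.X 0 ^ a₄₁ * MvPolynomial.X 1 ^ a₄₂,
          MvPolynomial.X 0 ^ a₄₁ * MvPolynomial.X 2 ^ a₂₃ -
            MvPolynomial.X 1 ^ a₁₂ * MvPolynomial.X 3 ^ a₃₄,
          MvPolynomial.X 1 ^ (a₂ + a₁₂) -
            MvPolynomial.X 0 ^ a₁ * MvPolynomial.X 2 ^ (a₂₃ - a₁₃) * MvPolynomial.X 3 ^ a₂₄,
          MvPolynomial.X 0 ^ (a₁ + a₄₁) * MvPolynomial.X 2 ^ (a₂₃ - a₁₃) -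
            MvPolynomial.X 1 ^ (2 * a₁₂) * MvPolynomial.X 3 ^ a₃₄] :
          Fin 7 → MvPolynomial (Fin 4) K))
        (MonomialCurve.toricIdeal K n)) ∧
    (a₃ < a₃₁ + a₃₄ → a₂ + a₁₂ < a₁ + (a₂₃ - a₁₃) + a₂₄ →
      MonomialCurve.IsMinimalGenerators
        (MonomialCurve.leastFormIdeal (MonomialCurve.toricIdeal K n))
        ![MvPolynomial.X 1 ^ a₁₂ * MvPolynomial.X 2 ^ a₁₃,
          MvPolynomial.X 2 ^ a₂₃ * MvPolynomial.X 3 ^ a₂₄,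
          MvPolynomial.X 2 ^ a₃,
          MvPolynomial.X 3 ^ a₄,
          MvPolynomial.X 0 ^ a₄₁ * MvPolynomial.X 2 ^ a₂₃,
          MvPolynomial.X 1 ^ (a₂ + a₁₂),
          MvPolynomial.X 1 ^ (2 * a₁₂) * MvPolynomial.X 3 ^ a₃₄]) ∧
    (a₃ < a₃₁ + a₃₄ → a₂ + a₁₂ = a₁ + (a₂₃ - a₁₃) + a₂₄ →
      MonomialCurve.IsMinimalGenerators
        (MonomialCurve.leastFormIdeal (MonomialCurve.toricIdeal K n))
        ![MvPolynomial.X 1 ^ a₁₂ * MvPolynomial.X 2 ^ a₁₃,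
          MvPolynomial.X 2 ^ a₂₃ * MvPolynomial.X 3 ^ a₂₄,
          MvPolynomial.X 2 ^ a₃,
          MvPolynomial.X 3 ^ a₄,
          MvPolynomial.X 0 ^ a₄₁ * MvPolynomial.X 2 ^ a₂₃,
          MvPolynomial.X 1 ^ (a₂ + a₁₂) -
            MvPolynomial.X 0 ^ a₁ * MvPolynomial.X 2 ^ (a₂₃ - a₁₃) * MvPolynomial.X 3 ^ a₂₄,
          MvPolynomial.X 1 ^ (2 * a₁₂) * MvPolynomial.X 3 ^ a₃₄]) ∧
    (a₃ = a₃₁ + a₃₄ → a₂ + a₁₂ < a₁ + (a₂₃ - a₁₃) + a₂₄ →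
      MonomialCurve.IsMinimalGenerators
        (MonomialCurve.leastFormIdeal (MonomialCurve.toricIdeal K n))
        ![MvPolynomial.X 1 ^ a₁₂ * MvPolynomial.X 2 ^ a₁₃,
          MvPolynomial.X 2 ^ a₂₃ * MvPolynomial.X 3 ^ a₂₄,
          MvPolynomial.X 2 ^ a₃ - MvPolynomial.X 0 ^ a₃₁ * MvPolynomial.X 3 ^ a₃₄,
          MvPolynomial.X 3 ^ a₄,
          MvPolynomial.X 0 ^ a₄₁ * MvPolynomial.X 2 ^ a₂₃,
          MvPolynomial.X 1 ^ (a₂ + a₁₂),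
          MvPolynomial.X 1 ^ (2 * a₁₂) * MvPolynomial.X 3 ^ a₃₄]) ∧
    (a₃ = a₃₁ + a₃₄ → a₂ + a₁₂ = a₁ + (a₂₃ - a₁₃) + a₂₄ →
      MonomialCurve.IsMinimalGenerators
        (MonomialCurve.leastFormIdeal (MonomialCurve.toricIdeal K n))
        ![MvPolynomial.X 1 ^ a₁₂ * MvPolynomial.X 2 ^ a₁₃,
          MvPolynomial.X 2 ^ a₂₃ * MvPolynomial.X 3 ^ a₂₄,
          MvPolynomial.X 2 ^ a₃ - MvPolynomial.X 0 ^ a₃₁ * MvPolynomial.X 3 ^ a₃₄,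
          MvPolynomial.X 3 ^ a₄,
          MvPolynomial.X 0 ^ a₄₁ * MvPolynomial.X 2 ^ a₂₃,
          MvPolynomial.X 1 ^ (a₂ + a₁₂) -
            MvPolynomial.X 0 ^ a₁ * MvPolynomial.X 2 ^ (a₂₃ - a₁₃) * MvPolynomial.X 3 ^ a₂₄,
          MvPolynomial.X 1 ^ (2 * a₁₂) * MvPolynomial.X 3 ^ a₃₄]) := by
  have hmin := hC.isMinimalGenerators_binomialForm hmono hpos h₅ h₁₃
  obtain ⟨d1, d2, d4⟩ := hC.degree_lt hmono
  obtain ⟨e1, e2, e3, e4⟩ := hC.relations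
  refine ⟨fun h₃ h₆ => ?_, fun h₃ h₆ => ?_, fun h₃ h₆ => ?_, fun h₃ h₆ => ?_, fun h₃ h₆ => ?_⟩
  · obtain ⟨F, hF, hF'⟩ := hC.exists_normalForm hmono hpos h₅ h₁₃ h₃ h₆
    refine MonomialCurve.isStandardBasis_of_normalForm (hC.degFirstLT hmono h₅ h₃ h₆)
      (hC.binomial_mem h₁₃) hF hF' fun i => ?_
    fin_cases i <;> simp [MonomialCurve.leadExp, MonomialCurve.tailExp,
      MonomialCurve.binomial_expVec]
  -- The four cases differ only in whether f₃ and f₆ are homogeneous; the other least forms are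
  -- always monomials.
  all_goals
    convert hmin (by omega) (by omega) using 1
    funext i
    fin_cases i <;> simp only [MonomialCurve.leadExp, MonomialCurve.tailExp] <;> first
      | (refine .symm ((MonomialCurve.binomialForm_expVec_of_degree_lt ?_).trans ?_)
         · omega
         · simp)
      | (refine .symm ((MonomialCurve.binomialForm_expVec_of_degree_eq ?_).trans ?_)
         · omega
         · simp)
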